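/- All structures are finite (with nonempty universe) over finite relational vocabularies. A generalized (Lindström) quantifier $Q_{\mathcal K}$ is given by an isomorphism-closed class $\mathcal K$ of $\tau$-structures; its arity is the maximum arity of a relation symbol in $\tau$, and $\mathcal Q_r$ is the collection of all quantifiers of arity at most $r$. For a set $A$ let $m_A\colon A^3\to A$ be the partial Maltsev function: $m_A(a,a,b)=m_A(b,a,a)=b$, and $m_A(a,b,c)$ is undefined if $a\neq b$ and $b\neq c$. For a relation $R\subseteq A^n$ let $m_A(R)$ be the set of all tuples obtained by applying $m_A$ coordinatewise to three tuples of $R$ such that $m_A$ is defined in every coordinate, and for a $\tau$-structure $\mathbf B$ let $m_B(\mathbf B)$ be the structure on $B$ with the relations $m_B(R^{\mathbf B})$, $R \in \tau$. The quantifier $Q_{\mathcal K}$ is Maltsev-closed if for every $\mathbf B\in\mathcal K$, every structure $\mathbf A$ on the same universe with $R^{\mathbf A}\subseteq R^{\mathbf B}\cup m_B(R^{\mathbf B})$ for all $R\in\tau$ is in $\mathcal K$. Let $\mathcal Q^{\mathcal M}_r$ be the collection of all Maltsev-closed quantifiers in $\mathcal Q_r$. For a collection $\mathcal Q$ of quantifiers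 let $\mathcal L(\mathcal Q)=\bigcup_{k}\mathcal L^k(\mathcal Q)$, where $\mathcal L^k(\mathcal Q)$ is the extension of the infinitary logic with $k$ variables by all quantifiers in $\mathcal Q$. Write $\mathcal L(\mathcal Q)\le\mathcal L(\mathcal Q')$ if every sentence of $\mathcal L(\mathcal Q)$ is equivalent, over finite structures, to a sentence of $\mathcal L(\mathcal Q')$, and $\mathcal L(\mathcal Q)\lneq\mathcal L(\mathcal Q')$ if moreover $\mathcal L(\mathcal Q')\not\le\mathcal L(\mathcal Q)$. **Theorem.** For every $r\ge 3$, $$\mathcal L(\mathcal Q^{\mathcal M}_r)\lneq \mathcal L(\mathcal Q^{\mathcal M}_{r+1}).$$ Moreover, let $\mathbf B_{r+1}=(\{0,1\},R_0,R_1)$ with $R_i=\{(a_1,\dots,a_{r+1})\mid \sum_{j} a_j\equiv i \pmod 2\}$, and let $\mathrm{CSP}(\mathbf B_{r+1})$ be the class of all finite structures that admit a homomorphism to $\mathbf B_{r+1}$. Then $\mathbf B_{r+1}$ has a Maltsev polymorphism (a total polymorphism $m$ with $m(a,a,b)=m(b,a,a)=b$ for all $a,b$), the quantifier $Q_{\mathrm{CSP}(\mathbf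 B_{r+1})}$ is in $\mathcal Q^{\mathcal M}_{r+1}$, and $\mathrm{CSP}(\mathbf B_{r+1})$ is definable in $\mathcal L(\mathcal Q^{\mathcal M}_{r+1})$ but not in $\mathcal L(\mathcal Q_r)$. -/

import Mathlib

namespace GenQuant

open FirstOrder

/-! ### Finite relational structures -/

/-- A finite structure (with nonempty universe) over the vocabulary `τ`. -/
structure FinStructure (τ : FirstOrder.Language.{0, 0}) where
  Carrier : Type
  [str : τ.Structure Carrier]
  [fin : Finite Carrier]
  [nonem : Nonempty Carrier]

attribute [instance] FinStructure.str FinStructure.fin FinStructure.nonem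

/-- The vocabularies under consideration: finite sets of relation symbols. -/
class FinRelational (τ : FirstOrder.Language.{0, 0}) : Prop where
  relational : τ.IsRelational
  finite : Finite (Σ n, τ.Relations n)

attribute [instance] FinRelational.relational FinRelational.finite

/-- The structure on `A` in which every symbol `R` is interpreted by the relation `rel n R`. -/
@[reducible] def ofRelations {τ : FirstOrder.Language.{0, 0}} [FinRelational τ] {A : Type}
    (rel : ∀ n, τ.Relations n → Set (Fin n → A)) : τ.Structure A where
  funMap := fun f => isEmptyElim f
  RelMap := fun {n} R a => a ∈ rel n R

/-- The interpretation of the symbol `R` in the structure `S` on `A`, as a set of tuples. -/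
def relOf {τ : FirstOrder.Language.{0, 0}} {A : Type} (S : τ.Structure A) {n : ℕ} (R : τ.Relations n) :
    Set (Fin n → A) :=
  {a | S.RelMap R a}

/-- `S ≤ T` for two structures on the same universe: every relation of `S` is contained in the
corresponding relation of `T`. -/
def StrLE {τ : FirstOrder.Language.{0, 0}} {A : Type} (S T : τ.Structure A) : Prop :=
  ∀ (n : ℕ) (R : τ.Relations n), relOf S R ⊆ relOf T R

/-- The union of two structures on the same universe. -/
@[reducible] def strUnion {τ : FirstOrder.Language.{0, 0}} [FinRelational τ] {A : Type} (S T : τ.Structure A) :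
    τ.Structure A :=
  ofRelations fun _ R => relOf S R ∪ relOf T R

/-! ### Generalized (Lindström) quantifiers -/

/-- A generalized quantifier: a finite relational vocabulary together with an
isomorphism-closed class of finite structures of that vocabulary. -/
structure Quantifier where
  voc : FirstOrder.Language.{0, 0}
  [finRel : FinRelational voc]
  cls : Set (FinStructure voc)
  iso_closed : ∀ A B : FinStructure voc,
    A ∈ cls → Nonempty (A.Carrier ≃[voc] B.Carrier) → B ∈ cls

attribute [instance] Quantifier.finRel

/-- The structure with universe `A` and relations `rel n R` belongs to the class of `q`. -/
def Quantifier.Holds (q : Quantifier) (A : Type) [Finite A] [Nonempty A]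
    (rel : ∀ n, q.voc.Relations n → Set (Fin n → A)) : Prop :=
  FinStructure.mk (str := ofRelations rel) A ∈ q.cls

/-- `𝒬_r`: the collection of all quantifiers of arity at most `r`. -/
def quantifiersOfArity (r : ℕ) : Set Quantifier :=
  {q | ∀ n, Nonempty (q.voc.Relations n) → n ≤ r}

/-! ### The logics `𝓛(𝒬)` -/

/-- Formulas of `𝓛^k(𝒬)` of vocabulary `σ`: infinitary logic with the `k` variables indexed by
`Fin k`, extended by the quantifiers in `𝒬`. In `quant q hq y ψ`, the tuple of distinct variables
`y n R` is bound in the formula `ψ n R`, for each relation symbol `R` of the vocabulary of `q`.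
The remaining connectives (disjunctions, universal quantifier) are expressed by negation. -/
inductive Formula (𝒬 : Set Quantifier) (σ : FirstOrder.Language.{0, 0}) (k : ℕ) : Type 1
  | equal (i j : Fin k) : Formula 𝒬 σ k
  | rel (n : ℕ) (R : σ.Relations n) (v : Fin n → Fin k) : Formula 𝒬 σ k
  | neg (φ : Formula 𝒬 σ k) : Formula 𝒬 σ k
  | conj (ι : Type) (φ : ι → Formula 𝒬 σ k) : Formula 𝒬 σ k
  | ex (i : Fin k) (φ : Formula 𝒬 σ k) : Formula 𝒬 σ k
  | quant (q : Quantifier) (hq : q ∈ 𝒬)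
      (y : ∀ n, q.voc.Relations n → (Fin n ↪ Fin k))
      (ψ : ∀ n, q.voc.Relations n → Formula 𝒬 σ k) : Formula 𝒬 σ k

/-- The set of free variables of a formula. -/
def Formula.free {𝒬 : Set Quantifier} {σ : FirstOrder.Language.{0, 0}} {k : ℕ} :
    Formula 𝒬 σ k → Set (Fin k)
  | .equal i j => {i, j}
  | .rel _ _ v => Set.range v
  | .neg φ => φ.free
  | .conj _ φ => {x | ∃ i, x ∈ (φ i).free}
  | .ex i φ => φ.free \ {i}
  | .quant _ _ y ψ => {x | ∃ n R, x ∈ (ψ n R).free ∧ x ∉ Set.range (y n R)}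

/-- `φ.Sat A α` means `(A, α) ⊨ φ`. Here `Function.extend (y n R) b α` is the assignment
`α[b / y n R]`. -/
def Formula.Sat {𝒬 : Set Quantifier} {σ : FirstOrder.Language.{0, 0}} {k : ℕ} (A : FinStructure σ) :
    Formula 𝒬 σ k → (Fin k → A.Carrier) → Prop
  | .equal i j, α => α i = α j
  | .rel _ R v, α => A.str.RelMap R (fun s => α (v s))
  | .neg φ, α => ¬ φ.Sat A α
  | .conj _ φ, α => ∀ i, (φ i).Sat A α
  | .ex i φ, α => ∃ a : A.Carrier, φ.Sat A (Function.update α i a)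
  | .quant q _ y ψ, α =>
      q.Holds A.Carrier fun n R => {b | (ψ n R).Sat A (Function.extend (y n R) b α)}

/-- A class of finite `σ`-structures is definable in `𝓛(𝒬) = ⋃ₖ 𝓛^k(𝒬)` if it is the class of
models of a sentence (a formula without free variables). -/
def Definable (𝒬 : Set Quantifier) {σ : FirstOrder.Language.{0, 0}} (C : Set (FinStructure σ)) : Prop :=
  ∃ (k : ℕ) (φ : Formula 𝒬 σ k), φ.free = ∅ ∧
    ∀ A : FinStructure σ, A ∈ C ↔ ∀ α : Fin k → A.Carrier, φ.Sat A α

/-- `𝓛(𝒬) ≤ 𝓛(𝒬')`: every sentence of `𝓛(𝒬)`, over any finite relational vocabulary, is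
equivalent over finite structures to a sentence of `𝓛(𝒬')`. -/
def LogicLE (𝒬 𝒬' : Set Quantifier) : Prop :=
  ∀ (σ : FirstOrder.Language.{0, 0}) [FinRelational σ] (C : Set (FinStructure σ)),
    Definable 𝒬 C → Definable 𝒬' C

/-- `𝓛(𝒬)` is strictly weaker than `𝓛(𝒬')`. -/
def LogicLT (𝒬 𝒬' : Set Quantifier) : Prop :=
  LogicLE 𝒬 𝒬' ∧ ¬ LogicLE 𝒬' 𝒬

/-! ### Closure under partial polymorphisms -/

/-- A family of `l`-ary partial functions, one on every set. -/
abbrev PartialFamily (l : ℕ) := ∀ A : Type, (Fin l → A) →. A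

/-- `p(R)`: all tuples obtained by applying `p` column-wise to `l` tuples of `R` (the rows
`M 0, …, M (l - 1)` of a matrix) such that `p` is defined on every column. -/
def relImage {l : ℕ} {A : Type} (p : (Fin l → A) →. A) {n : ℕ} (R : Set (Fin n → A)) :
    Set (Fin n → A) :=
  {b | ∃ M : Fin l → Fin n → A, (∀ i, M i ∈ R) ∧ ∀ j, b j ∈ p (fun i => M i j)}

/-- `p(S)`: the structure whose relations are the `p(R)` for the relations `R` of `S`. -/
@[reducible] def strImage {τ : FirstOrder.Language.{0, 0}} [FinRelational τ] {l : ℕ} {A : Type} (p : (Fin l → A) →. A)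
    (S : τ.Structure A) : τ.Structure A :=
  ofRelations fun _ R => relImage p (relOf S R)

/-- A quantifier with class `𝒦` is `P`-closed if `𝐁 ∈ 𝒦` and `𝐀 ≤ 𝐁 ∪ p_B(𝐁)` imply
`𝐀 ∈ 𝒦`. -/
def PClosed {l : ℕ} (P : PartialFamily l) (q : Quantifier) : Prop :=
  ∀ (B : Type) [Finite B] [Nonempty B] (SA SB : q.voc.Structure B),
    FinStructure.mk (str := SB) B ∈ q.cls →
    StrLE SA (strUnion SB (strImage (P B) SB)) →
    FinStructure.mk (str := SA) B ∈ q.cls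

open Classical in
/-- The partial Maltsev family: `m(a, a, b) = m(b, a, a) = b`, and `m(a, b, c)` is undefined if
`a ≠ b` and `b ≠ c`. -/
noncomputable def maltsev : PartialFamily 3 := fun _ x =>
  ⟨x 0 = x 1 ∨ x 1 = x 2, fun _ => if x 0 = x 1 then x 2 else x 0⟩

theorem mem_maltsev {A : Type} (a b c d : A) :
    d ∈ maltsev A ![a, b, c] ↔ (a = b ∧ d = c) ∨ (b = c ∧ d = a) := by
  classical
  simp only [maltsev, Part.mem_mk_iff]
  by_cases h : a = b
  · subst h
    simp only [Matrix.cons_val]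
    grind
  · simp only [Matrix.cons_val]
    grind

/-- `𝒬^𝓜_r`: the quantifiers of arity at most `r` closed under the partial Maltsev family. -/
def maltsevQuantifiers (r : ℕ) : Set Quantifier :=
  {q | q ∈ quantifiersOfArity r ∧ PClosed maltsev q}

/-! ### Constraint satisfaction problems and the parity template -/

/-- `CSP(𝐁)`: the class of all finite structures with a homomorphism to `𝐁`. -/
def CSP {τ : FirstOrder.Language.{0, 0}} (B : FinStructure τ) : Set (FinStructure τ) :=
  {A | Nonempty (A.Carrier →[τ] B.Carrier)}

/-- The CSP quantifier with template `𝐁`. -/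
abbrev cspQuantifier {τ : FirstOrder.Language.{0, 0}} [FinRelational τ] (B : FinStructure τ) : Quantifier where
  voc := τ
  cls := CSP B
  iso_closed := fun _ _ ⟨h⟩ ⟨e⟩ => ⟨h.comp e.symm.toHom⟩

/-- `𝐁` has a (total) polymorphism `m` satisfying the Maltsev identities
`m(a, a, b) = m(b, a, a) = b`. -/
def HasMaltsevPolymorphism {τ : FirstOrder.Language.{0, 0}} (B : FinStructure τ) : Prop :=
  ∃ m : B.Carrier → B.Carrier → B.Carrier → B.Carrier,
    (∀ a b, m a a b = b ∧ m b a a = b) ∧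
    ∀ (n : ℕ) (R : τ.Relations n), ∀ x ∈ relOf B.str R, ∀ y ∈ relOf B.str R, ∀ z ∈ relOf B.str R,
      (fun j => m (x j) (y j) (z j)) ∈ relOf B.str R

/-- Two relation symbols `R₀, R₁`, both of arity `r`. -/
inductive ParityRel (r : ℕ) : ℕ → Type
  | R (i : ZMod 2) : ParityRel r r

/-- The vocabulary `{R₀, R₁}` of the parity template. -/
abbrev parityVoc (r : ℕ) : FirstOrder.Language.{0, 0} := ⟨fun _ => Empty, ParityRel r⟩

instance parityVoc_finRelational (r : ℕ) : FinRelational (parityVoc r) where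
  relational := fun _ => inferInstanceAs (IsEmpty Empty)
  finite := Finite.of_surjective
    (fun i : ZMod 2 => (⟨r, ParityRel.R i⟩ : Σ n, (parityVoc r).Relations n))
    (by rintro ⟨_, ⟨i⟩⟩; exact ⟨i, rfl⟩)

/-- The tuples over `{0, 1}` of the relation named by a symbol: `R i` names the set of all
`(a₁, …, a_r)` with `a₁ + ⋯ + a_r = i` modulo `2`. -/
def parityRelation (r : ℕ) : ∀ n, ParityRel r n → Set (Fin n → ZMod 2)
  | _, .R i => {a | ∑ j, a j = i}

/-- The parity template `𝐁_r = ({0, 1}, R₀, R₁)`. -/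
def parityTemplate (r : ℕ) : FinStructure (parityVoc r) where
  Carrier := ZMod 2
  str := ofRelations (parityRelation r)
  fin := inferInstanceAs (Finite (ZMod 2))
  nonem := inferInstanceAs (Nonempty (ZMod 2))

end GenQuant

namespace GenQuant

open FirstOrder

/-! ### Elementary facts about the logics -/

/-! Only the undefinability of parity CSPs in `𝓛(𝒬_r)` is hard; the total Maltsev operation `x + y +
z` puts the CSP quantifier into the Maltsev-closed class, and adding quantifiers preserves
definability. Write `r = q + 2` and put one linear equation mod 2 at each vertex of an `(r +
1)`-regular multigraph, with the edges as unknowns. Each edge has two ends, so a solvable system has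
right-hand sides of sum 0: the zero system is solvable, and one with a single 1 is not. Given `k`
variables, the two structures are compared by shifts of the edge values that are correct except at
one root, in a gadget avoided by all assigned edges. A quantifier changes at most `r` values under
one fixed bijection. Among the `r + 1` legs at the root, one index is unused by the new values, and
along it the error moves to an untouched gadget on the other side without changing the shift at any
assigned value (`exists_twistedAt_of_card_le`). Hence `Formula.sat_iff_of_backAndForth` applies. -/

theorem Formula.exists_mono {𝒬 𝒬' : Set Quantifier} (h : 𝒬 ⊆ 𝒬') {σ : FirstOrder.Language.{0, 0}}
    {k : ℕ} (φ : Formula 𝒬 σ k) :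
    ∃ φ' : Formula 𝒬' σ k, φ'.free = φ.free ∧
      ∀ (A : FinStructure σ) (α : Fin k → A.Carrier), φ'.Sat A α ↔ φ.Sat A α := by
  induction φ with
  | equal i j => exact ⟨.equal i j, rfl, fun _ _ => Iff.rfl⟩
  | rel n R v => exact ⟨.rel n R v, rfl, fun _ _ => Iff.rfl⟩
  | neg φ ih =>
    obtain ⟨φ', hf, hs⟩ := ih
    exact ⟨.neg φ', hf, fun A α => not_congr (hs A α)⟩
  | conj ι φ ih =>
    choose φ' hf hs using ih
    exact ⟨.conj ι φ', by simp only [Formula.free, hf],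
      fun A α => forall_congr' fun i => hs i A α⟩
  | ex i φ ih =>
    obtain ⟨φ', hf, hs⟩ := ih
    exact ⟨.ex i φ', by simp only [Formula.free, hf], fun A α => exists_congr fun a => hs A _⟩
  | quant q hq y ψ ih =>
    choose ψ' hf hs using ih
    exact ⟨.quant q (h hq) y ψ', by simp only [Formula.free, hf],
      fun A α => by simp only [Formula.Sat, hs]⟩

theorem Definable.mono {𝒬 𝒬' : Set Quantifier} (h : 𝒬 ⊆ 𝒬') {σ : FirstOrder.Language.{0, 0}}
    {C : Set (FinStructure σ)} (hC : Definable 𝒬 C) : Definable 𝒬' C := by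
  obtain ⟨k, φ, hf, hs⟩ := hC
  obtain ⟨φ', hf', hs'⟩ := φ.exists_mono h
  exact ⟨k, φ', hf'.trans hf, fun A => by simp only [hs, hs']⟩

theorem maltsevQuantifiers_subset_succ (r : ℕ) :
    maltsevQuantifiers r ⊆ maltsevQuantifiers (r + 1) :=
  fun _ hq => ⟨fun n hn => (hq.1 n hn).trans r.le_succ, hq.2⟩

/-- Quantifiers do not distinguish families of relations related by a bijection. -/
theorem Quantifier.holds_congr (q : Quantifier) {A B : Type} [Finite A] [Nonempty A] [Finite B]
    [Nonempty B] (e : A ≃ B) {S : ∀ n, q.voc.Relations n → Set (Fin n → A)}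
    {T : ∀ n, q.voc.Relations n → Set (Fin n → B)}
    (h : ∀ n R b, b ∈ S n R ↔ e ∘ b ∈ T n R) : q.Holds A S ↔ q.Holds B T := by
  let SA := ofRelations S
  let SB := ofRelations T
  have iso : A ≃[q.voc] B :=
    { toEquiv := e
      map_fun' := fun f => isEmptyElim f
      map_rel' := fun R b => (h _ R b).symm }
  exact ⟨fun hA => q.iso_closed _ _ hA ⟨iso⟩, fun hB => q.iso_closed _ _ hB ⟨iso.symm⟩⟩

theorem comp_extend {ι κ A B : Type*} (f : A → B) (y : ι ↪ κ) (b : ι → A) (α : κ → A) :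
    f ∘ Function.extend y b α = Function.extend y (f ∘ b) (f ∘ α) := by
  funext x
  by_cases hx : ∃ s, y s = x
  · obtain ⟨s, rfl⟩ := hx
    simp [y.injective.extend_apply]
  · simp [Function.extend_apply' _ _ _ hx]

/-- A family of bijections between `A` and `B`, indexed by states, from which `𝓛^k(𝒬_r)`-equivalence
follows: the assignments of `A` are related to those of `B` by composition with the bijection, and
after a change of at most `r` values another state takes over. -/
theorem Formula.sat_iff_of_backAndForth {σ : FirstOrder.Language.{0, 0}} {A B : FinStructure σ}
    {r k : ℕ} (hr : 1 ≤ r) {Γ : Type*} (f : Γ → (A.Carrier ≃ B.Carrier))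
    (Good : (Fin k → A.Carrier) → Γ → Prop)
    (hrel : ∀ α c, Good α c → ∀ n (R : σ.Relations n) (v : Fin n → Fin k),
      A.str.RelMap R (fun s => α (v s)) ↔ B.str.RelMap R (fun s => f c (α (v s))))
    (hstep : ∀ α c, Good α c → ∀ (α' : Fin k → A.Carrier) (T : Finset (Fin k)), T.card ≤ r →
      (∀ x, x ∉ T → α' x = α x) → ∃ c', Good α' c' ∧ ∀ x, f c' (α' x) = f c (α' x))
    (φ : Formula (quantifiersOfArity r) σ k) :
    ∀ α c, Good α c → (φ.Sat A α ↔ φ.Sat B (f c ∘ α)) := by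
  induction φ with
  | equal i j => exact fun α c _ => (f c).injective.eq_iff.symm
  | rel n R v => exact fun α c h => hrel α c h n R v
  | neg φ ih => exact fun α c h => not_congr (ih α c h)
  | conj ι φ ih => exact fun α c h => forall_congr' fun i => ih i α c h
  | ex i φ ih =>
    intro α c h
    refine (f c).exists_congr fun a => ?_
    obtain ⟨c', hc', hf⟩ := hstep α c h (Function.update α i a) {i} (by simpa using hr)
      (fun x hx => Function.update_of_ne (by simpa using hx) _ _)
    rw [ih _ c' hc', show f c' ∘ Function.update α i a = f c ∘ Function.update α i a from
      funext hf, Function.comp_update]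
  | quant q hq y ψ ih =>
    intro α c h
    -- The bijection is fixed for all tuples `b`; only the next state `c'` may depend on `b`.
    refine q.holds_congr (f c) fun n R b => ?_
    obtain ⟨c', hc', hf⟩ := hstep α c h (Function.extend (y n R) b α)
      (Finset.univ.map (y n R)) (by simpa using hq n ⟨R⟩)
      (fun x hx => Function.extend_apply' _ _ _ (by simpa using hx))
    rw [Set.mem_ofPred_eq, ih n R _ c' hc', Set.mem_ofPred_eq,
      show f c' ∘ Function.extend (y n R) b α = f c ∘ Function.extend (y n R) b α from funext hf,
      comp_extend]

/-! ### The parity quantifier -/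

theorem hasMaltsevPolymorphism_parityTemplate (r : ℕ) :
    HasMaltsevPolymorphism (parityTemplate r) := by
  refine ⟨fun a b c : ZMod 2 => a + b + c, ?_, ?_⟩
  · exact (by decide : ∀ a b : ZMod 2, a + a + b = b ∧ b + a + a = b)
  · rintro _ ⟨i⟩ x hx y hy z hz
    have key (x y z : Fin r → ZMod 2) (hx : ∑ j, x j = i) (hy : ∑ j, y j = i)
        (hz : ∑ j, z j = i) : ∑ j, (x j + y j + z j) = i := by
      rw [Finset.sum_add_distrib, Finset.sum_add_distrib, hx, hy, hz, CharTwo.add_self_eq_zero,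
        zero_add]
    exact key x y z hx hy hz

/-- A map that is a homomorphism with respect to a structure into a structure with a Maltsev
polymorphism remains one after closing the relations under the partial Maltsev function. -/
theorem pClosed_maltsev_cspQuantifier {τ : FirstOrder.Language.{0, 0}} [FinRelational τ]
    {B : FinStructure τ} (hB : HasMaltsevPolymorphism B) : PClosed maltsev (cspQuantifier B) := by
  obtain ⟨m, hm, hpol⟩ := hB
  rintro A _ _ SA SB ⟨h⟩ hle
  refine ⟨@Language.Hom.mk τ A B.Carrier SA _ h.toFun (fun f => isEmptyElim f) ?_⟩
  intro n R x hx
  rcases hle n R hx with hx | ⟨M, hM, hx⟩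
  · exact h.map_rel' R x hx
  · have key := hpol n R _ (h.map_rel' R _ (hM 0)) _ (h.map_rel' R _ (hM 1)) _
      (h.map_rel' R _ (hM 2))
    -- Where the partial function is defined, two neighbouring entries agree, so the identities
    -- alone determine `m` on the images.
    suffices h.toFun ∘ x = fun j => m (h.toFun (M 0 j)) (h.toFun (M 1 j)) (h.toFun (M 2 j)) by
      rw [this]
      exact key
    funext j
    have hj := hx j
    rw [show (fun i => M i j) = ![M 0 j, M 1 j, M 2 j] by ext i; fin_cases i <;> rfl,
      mem_maltsev] at hj
    rcases hj with ⟨h1, h2⟩ | ⟨h1, h2⟩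
    · simp only [Function.comp_apply, h1, h2, (hm _ _).1]
    · simp only [Function.comp_apply, h1, h2, (hm _ _).2]

theorem cspQuantifier_parityTemplate_mem (r : ℕ) :
    cspQuantifier (parityTemplate r) ∈ maltsevQuantifiers r := by
  refine ⟨?_, pClosed_maltsev_cspQuantifier (hasMaltsevPolymorphism_parityTemplate r)⟩
  rintro _ ⟨⟨i⟩⟩
  exact le_rfl

/-- Apply the quantifier to atomic formulas; `r` variables suffice, since every symbol can bind an
initial segment of them. -/
theorem Quantifier.definable_cls (q : Quantifier) {𝒬 : Set Quantifier} (hq : q ∈ 𝒬) {r : ℕ}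
    (hr : q ∈ quantifiersOfArity r) : Definable 𝒬 q.cls := by
  refine ⟨r, .quant q hq (fun n R => Fin.castLEEmb (hr n ⟨R⟩))
    (fun n R => .rel n R (Fin.castLEEmb (hr n ⟨R⟩))), ?_, fun A => ?_⟩
  · ext x
    simp only [Formula.free, Set.mem_ofPred_eq, Set.mem_empty_iff_false, iff_false]
    rintro ⟨n, R, h1, h2⟩
    exact h2 h1
  · have key : ∀ α : Fin r → A.Carrier,
        Formula.Sat A (.quant q hq (fun n R => Fin.castLEEmb (hr n ⟨R⟩))
          (fun n R => .rel n R (Fin.castLEEmb (hr n ⟨R⟩)))) α ↔ A ∈ q.cls := by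
      intro α
      let S : q.voc.Structure A.Carrier := ofRelations fun _ R => {b | A.str.RelMap R b}
      have hS : S = A.str := by
        refine Language.Structure.ext ?_ ?_
        · funext n f
          exact isEmptyElim f
        · rfl
      have : q.Holds A.Carrier (fun n R => {b | A.str.RelMap R b}) ↔ A ∈ q.cls := by
        change FinStructure.mk (str := S) A.Carrier ∈ q.cls ↔ _
        rw [hS]
      rw [← this]
      refine q.holds_congr (Equiv.refl _) fun n R b => ?_
      simp only [Formula.Sat, Set.mem_ofPred_eq,
        (Fin.castLEEmb (hr n ⟨R⟩)).injective.extend_apply]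
      rfl
    exact ⟨fun h α => (key α).2 h, fun h => (key fun _ => Classical.arbitrary _).1 (h _)⟩

/-! ### A regular multigraph that is hard to search

Gadgets are indexed by a side and an element of `Fin M`. Each consists of two roots, joined by
`q + 3` disjoint legs. Each leg has `M` inner nodes, and the `j`-th of them is joined by `q + 1`
parallel edges to the gadget with index `j` on the other side. -/

/-- The vertices: the two roots of each gadget, and the inner nodes of its legs. -/
inductive ThetaVertex (q M : ℕ) : Type
  | root (β : Bool) (i : Fin M) (far : Bool)
  | node (β : Bool) (i : Fin M) (a : Fin (q + 2 + 1)) (t : Fin M)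
  deriving DecidableEq, Fintype

/-- The edges: the edges of the legs, and the edges that join gadget `i` on the side `true` to
gadget `j` on the side `false`. -/
inductive ThetaEdge (q M : ℕ) : Type
  | leg (β : Bool) (i : Fin M) (a : Fin (q + 2 + 1)) (t : Fin (M + 1))
  | cross (i j : Fin M) (a : Fin (q + 2 + 1)) (s : Fin (q + 1))
  deriving DecidableEq, Fintype

namespace ThetaEdge

variable {q M : ℕ}

/-- The leg to which an edge belongs or is attached. -/
def legIndex : ThetaEdge q M → Fin (q + 2 + 1)
  | leg _ _ a _ => a
  | cross _ _ a _ => a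

/-- The cross edge from gadget `i` on the side `β` to gadget `j` on the other side. -/
def crossFrom : Bool → Fin M → Fin M → Fin (q + 2 + 1) → Fin (q + 1) → ThetaEdge q M
  | true, i, j, a, s => cross i j a s
  | false, i, j, a, s => cross j i a s

/-- The edge has an end in gadget `i` on the side `β`. -/
def Touches (β : Bool) (i : Fin M) : ThetaEdge q M → Prop
  | leg β' i' _ _ => β' = β ∧ i' = i
  | cross i' j' _ _ => (bif β then i' else j') = i

theorem Touches.unique {β : Bool} {i j : Fin M} {e : ThetaEdge q M} (hi : e.Touches β i)
    (hj : e.Touches β j) : i = j := by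
  cases e with
  | leg => exact hi.2.symm.trans hj.2
  | cross => exact hi.symm.trans hj

/-- The indicator of the path from the near root of gadget `i` on the side `β` to the near root
of gadget `j` on the other side that uses the legs with index `a`. -/
def path (β : Bool) (i j : Fin M) (a : Fin (q + 2 + 1)) : ThetaEdge q M → ZMod 2
  | leg β' i' a' t =>
    -- Edges `0, …, j` of a leg lead from the near root to its `j`-th inner node, which is attached
    -- to gadget `j` on the other side.
    if a' = a ∧ (β' = β ∧ i' = i ∧ t.val ≤ j.val ∨ β' = !β ∧ i' = j ∧ t.val ≤ i.val) then 1 else 0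
  | cross i' j' a' s =>
    if a' = a ∧ s = 0 ∧ i' = (bif β then i else j) ∧ j' = (bif β then j else i) then 1 else 0

theorem path_eq_zero {β : Bool} {i j : Fin M} {a : Fin (q + 2 + 1)} {e : ThetaEdge q M}
    (h : e.legIndex = a → ¬ e.Touches β i ∧ ¬ e.Touches (!β) j) : path β i j a e = 0 := by
  cases e with
  | leg β' i' a' t => simp only [legIndex, Touches] at h; grind [path]
  | cross i' j' a' s => cases β <;> simp only [legIndex, Touches] at h <;> grind [path]

end ThetaEdge

namespace ThetaVertex

variable {q M : ℕ}

open ThetaEdge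

/-- The edges at a vertex. -/
def edges : ThetaVertex q M → Fin (q + 2 + 1) → ThetaEdge q M
  | root β i false => fun a => leg β i a 0
  | root β i true => fun a => leg β i a (Fin.last M)
  | node β i a t => Fin.cons (α := fun _ => ThetaEdge q M) (leg β i a t.castSucc)
      (Fin.cons (α := fun _ => ThetaEdge q M) (leg β i a t.succ) fun s => crossFrom β i t a s)

theorem sum_edges_node (x : ThetaEdge q M → ZMod 2) (β : Bool) (i : Fin M) (a : Fin (q + 2 + 1))
    (t : Fin M) :
    ∑ j, x ((node β i a t).edges j) =
      x (leg β i a t.castSucc) + x (leg β i a t.succ) + ∑ s, x (crossFrom β i t a s) := by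
  simp only [edges, Fin.sum_univ_succ (n := q + 2), Fin.sum_univ_succ (n := q + 1), Fin.cons_zero,
    Fin.cons_succ, add_assoc]

theorem sum_vertex {N : Type*} [AddCommMonoid N] (f : ThetaVertex q M → N) :
    ∑ v, f v = ∑ β, ∑ i, (f (root β i false) + f (root β i true) + ∑ a, ∑ t, f (node β i a t)) := by
  let e : ThetaVertex q M ≃ (Bool × Fin M × Bool) ⊕ (Bool × Fin M × Fin (q + 2 + 1) × Fin M) :=
    { toFun := fun
        | root β i b => .inl (β, i, b)
        | node β i a t => .inr (β, i, a, t)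
      invFun := fun
        | .inl (β, i, b) => root β i b
        | .inr (β, i, a, t) => node β i a t
      left_inv := by rintro (_ | _) <;> rfl
      right_inv := by rintro (_ | _) <;> rfl }
  rw [← e.symm.sum_comp, Fintype.sum_sum_type]
  simp only [Fintype.sum_prod_type, Finset.sum_add_distrib, Fintype.sum_bool]
  simp only [e, Equiv.coe_fn_symm_mk]
  abel

/-- Every edge has exactly two ends. -/
theorem sum_sum_edges (x : ThetaEdge q M → ZMod 2) :
    ∑ v : ThetaVertex q M, ∑ j, x (v.edges j) = 0 := by
  have two (z : ZMod 2) : z + z = 0 := CharTwo.add_self_eq_zero z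
  have hleg (β : Bool) (i : Fin M) (a : Fin (q + 2 + 1)) :
      x (leg β i a 0) + x (leg β i a (Fin.last M)) +
        (∑ t : Fin M, x (leg β i a t.castSucc) + ∑ t : Fin M, x (leg β i a t.succ)) = 0 := by
    -- The near root and the upper edges of the inner nodes cover the leg once; so do the far root
    -- and the lower edges.
    rw [← two (∑ t, x (leg β i a t))]
    nth_rw 1 [Fin.sum_univ_castSucc]
    rw [Fin.sum_univ_succ]
    abel
  rw [sum_vertex]
  simp only [sum_edges_node, Finset.sum_add_distrib]
  have hlegs := Finset.sum_eq_zero fun (β : Bool) (_ : β ∈ Finset.univ) =>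
    Finset.sum_eq_zero fun (i : Fin M) (_ : i ∈ Finset.univ) =>
      Finset.sum_eq_zero fun a (_ : a ∈ Finset.univ) => hleg β i a
  -- Both sides list the same cross edges, with the two gadget indices exchanged.
  have hcross : ∑ β : Bool, ∑ i : Fin M, ∑ a, ∑ t : Fin M, ∑ s, x (crossFrom β i t a s) = 0 := by
    rw [Fintype.sum_bool]
    conv_lhs =>
      enter [2]
      rw [Finset.sum_comm]
      enter [2, a]
      rw [Finset.sum_comm]
    conv_lhs =>
      enter [1]
      rw [Finset.sum_comm]
    exact two _
  simp only [Finset.sum_add_distrib] at hlegs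
  rw [hcross, add_zero]
  exact hlegs

theorem sum_path_crossFrom (β : Bool) (i j : Fin M) (a : Fin (q + 2 + 1)) (β' : Bool) (i' : Fin M)
    (a' : Fin (q + 2 + 1)) (t : Fin M) :
    ∑ s, path β i j a (crossFrom β' i' t a' s) =
      if a' = a ∧ (β' = β ∧ i' = i ∧ t = j ∨ β' = !β ∧ i' = j ∧ t = i) then 1 else 0 := by
  rw [Fintype.sum_eq_single 0 fun s hs => by cases β' <;> simp [crossFrom, path, hs] ]
  cases β <;> cases β' <;> simp [crossFrom, path, and_comm]

/-- A path has even degree everywhere except at its two ends. -/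
theorem sum_path_edges (β : Bool) (i j : Fin M) (a : Fin (q + 2 + 1)) (v : ThetaVertex q M) :
    ∑ l, path β i j a (v.edges l) =
      (if v = root β i false then 1 else 0) + (if v = root (!β) j false then 1 else 0) := by
  have two : (1 : ZMod 2) + 1 = 0 := CharTwo.add_self_eq_zero 1
  obtain ⟨β', i', _ | _⟩ | ⟨β', i', a', t⟩ := v
  · simp only [edges, path, Fin.val_zero, Nat.zero_le, and_true, ite_and, Finset.sum_ite_eq',
      Finset.mem_univ, if_true]
    cases β <;> cases β' <;> simp
  · simp [edges, path, Nat.not_le.2]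
  · rw [sum_edges_node, sum_path_crossFrom]
    simp only [path, Fin.val_castSucc, Fin.val_succ, reduceCtorEq, if_false, Fin.ext_iff]
    cases β <;> cases β' <;> grind

end ThetaVertex

/-! ### Parity structures over the multigraph -/

section ParityStructures

variable {q M : ℕ}

open ThetaEdge ThetaVertex

/-- The relations on `ThetaEdge × ZMod 2` that express the equations "the sum of the values of the
edges at `v` is `b v`", for all vertices `v`. -/
def thetaRelation (b : ThetaVertex q M → ZMod 2) :
    ∀ n, ParityRel (q + 2 + 1) n → Set (Fin n → ThetaEdge q M × ZMod 2)
  | _, .R i => {x | ∃ v : ThetaVertex q M, (∀ j, (x j).1 = v.edges j) ∧ ∑ j, (x j).2 = i + b v}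

/-- The structure of the system of equations with right-hand sides `b`. -/
def thetaStructure [NeZero M] (b : ThetaVertex q M → ZMod 2) :
    FinStructure (parityVoc (q + 2 + 1)) where
  Carrier := ThetaEdge q M × ZMod 2
  str := ofRelations (thetaRelation b)
  nonem := ⟨(leg true 0 0 0, 0)⟩

theorem thetaStructure_zero_mem_csp [NeZero M] :
    thetaStructure (0 : ThetaVertex q M → ZMod 2) ∈ CSP (parityTemplate (q + 2 + 1)) := by
  refine ⟨⟨fun x : ThetaEdge q M × ZMod 2 => x.2, fun f => isEmptyElim f, ?_⟩⟩
  rintro _ ⟨i⟩ x ⟨v, -, hx⟩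
  exact hx.trans (add_zero i)

/-- The values of a homomorphism at the elements `(e, 0)` solve the system; adding all equations
counts each edge twice. -/
theorem sum_eq_zero_of_thetaStructure_mem_csp [NeZero M] {b : ThetaVertex q M → ZMod 2}
    (h : thetaStructure b ∈ CSP (parityTemplate (q + 2 + 1))) : ∑ v, b v = 0 := by
  obtain ⟨h⟩ := h
  let x : ThetaEdge q M → ZMod 2 := fun e => h.toFun (e, (0 : ZMod 2))
  rw [← sum_sum_edges x]
  refine Finset.sum_congr rfl fun v _ => Eq.symm ?_
  refine h.map_rel' (ParityRel.R (b v)) (fun j => (v.edges j, (0 : ZMod 2))) ⟨v, fun _ => rfl, ?_⟩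
  rw [Finset.sum_const_zero, CharTwo.add_self_eq_zero]

/-- Shift the values of each edge `e` by `c e`. -/
def shift (c : ThetaEdge q M → ZMod 2) : ThetaEdge q M × ZMod 2 ≃ ThetaEdge q M × ZMod 2 where
  toFun x := (x.1, x.2 + c x.1)
  invFun x := (x.1, x.2 - c x.1)
  left_inv x := by simp
  right_inv x := by simp

/-! ### Moving the twist -/

/-- The shift by `c` takes the homogeneous system to the one with right-hand sides `b`, except
at one root of the gadget `i` on the side `β`. -/
def TwistedAt (b : ThetaVertex q M → ZMod 2) (c : ThetaEdge q M → ZMod 2) (β : Bool) (i : Fin M) :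
    Prop :=
  ∀ v : ThetaVertex q M, ∑ j, c (v.edges j) = b v + if v = root β i false then 1 else 0

/-- The path cancels the error at its start and creates one at its end. -/
theorem TwistedAt.add_path {b : ThetaVertex q M → ZMod 2} {c : ThetaEdge q M → ZMod 2} {β : Bool}
    {i : Fin M} (h : TwistedAt b c β i) (j : Fin M) (a : Fin (q + 2 + 1)) :
    TwistedAt b (c + path β i j a) (!β) j := by
  intro v
  simp only [Pi.add_apply, Finset.sum_add_distrib, h v, sum_path_edges]
  rw [add_assoc, ← add_assoc (ite _ _ _), CharTwo.add_self_eq_zero, zero_add]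

/-- An edge touches at most one gadget on each side, so `k` edges cannot touch all `k + 1`. -/
theorem exists_gadget_untouched {k : ℕ} (β : Bool) (p : Fin k → ThetaEdge q (k + 1)) :
    ∃ i, ∀ x, ¬ (p x).Touches β i := by
  by_contra! h
  choose g hg using h
  have := Fintype.card_le_of_injective g fun i j hij => (hg i).unique (hij ▸ hg j)
  simp at this

/-- Only a tuple listing the edges at the twisted root could be mapped wrongly, and these edges
touch the avoided gadget. -/
theorem relMap_thetaStructure_shift [NeZero M] {k : ℕ} {b : ThetaVertex q M → ZMod 2}
    {c : ThetaEdge q M → ZMod 2} {β : Bool} {i : Fin M} (hc : TwistedAt b c β i)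
    {α : Fin k → ThetaEdge q M × ZMod 2} (hα : ∀ x, ¬ (α x).1.Touches β i) (n : ℕ)
    (R : ParityRel (q + 2 + 1) n) (v : Fin n → Fin k) :
    (fun s => α (v s)) ∈ thetaRelation (0 : ThetaVertex q M → ZMod 2) n R ↔
      (fun s => shift c (α (v s))) ∈ thetaRelation b n R := by
  obtain ⟨l⟩ := R
  refine exists_congr fun w => and_congr_right fun hw => ?_
  have hne : w ≠ root β i false := by
    rintro rfl
    exact hα (v 0) (by rw [hw 0]; exact ⟨rfl, rfl⟩)
  have hsum : ∑ j, c (α (v j)).1 = b w := by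
    simp only [hw]
    rw [hc w, if_neg hne, add_zero]
  simp only [shift, Equiv.coe_fn_mk, Finset.sum_add_distrib, hsum, Pi.zero_apply, add_zero,
    add_left_inj]

theorem exists_twistedAt_of_card_le {k : ℕ} {b : ThetaVertex q (k + 1) → ZMod 2}
    {c : ThetaEdge q (k + 1) → ZMod 2} {β : Bool} {i : Fin (k + 1)} (hc : TwistedAt b c β i)
    {p p' : Fin k → ThetaEdge q (k + 1)} (hp : ∀ x, ¬ (p x).Touches β i) {T : Finset (Fin k)}
    (hT : T.card ≤ q + 2) (hpp : ∀ x, x ∉ T → p' x = p x) :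
    ∃ c' j, TwistedAt b c' (!β) j ∧ (∀ x, ¬ (p' x).Touches (!β) j) ∧
      ∀ x, c' (p' x) = c (p' x) := by
  -- At most `q + 2` changed values cannot meet all `q + 3` leg indices.
  obtain ⟨a, ha⟩ : ∃ a, a ∉ T.image fun x => (p' x).legIndex := by
    by_contra! h
    have h1 := Finset.card_le_card (fun a _ => h a : Finset.univ ⊆ _)
    have h2 := Finset.card_image_le (s := T) (f := fun x => (p' x).legIndex)
    rw [Finset.card_univ, Fintype.card_fin] at h1
    omega
  obtain ⟨j, hj⟩ := exists_gadget_untouched (!β) p'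
  refine ⟨c + path β i j a, j, hc.add_path j a, hj, fun x => ?_⟩
  rw [Pi.add_apply, path_eq_zero, add_zero]
  intro hx
  refine ⟨?_, hj x⟩
  -- An edge with leg index `a` is assigned to an unchanged variable, so it avoids the old gadget.
  rw [hpp x fun hxT => ha (Finset.mem_image.2 ⟨x, hxT, hx⟩)]
  exact hp x

theorem not_definable_csp_parityTemplate (q : ℕ) :
    ¬ Definable (quantifiersOfArity (q + 2)) (CSP (parityTemplate (q + 2 + 1))) := by
  rintro ⟨k, φ, -, hφ⟩
  let b : ThetaVertex q (k + 1) → ZMod 2 := fun v => if v = root true 0 false then 1 else 0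
  let A := thetaStructure (0 : ThetaVertex q (k + 1) → ZMod 2)
  let B := thetaStructure b
  have hB : B ∉ CSP (parityTemplate (q + 2 + 1)) := by
    intro h
    have := sum_eq_zero_of_thetaStructure_mem_csp h
    simp [b] at this
  refine hB ((hφ B).2 fun γ => ?_)
  let p : Fin k → ThetaEdge q (k + 1) := fun x => (show ThetaEdge q (k + 1) × ZMod 2 from γ x).1
  obtain ⟨i, hi⟩ := exists_gadget_untouched true p
  have hc : TwistedAt b 0 true 0 := fun v => by
    simp only [Pi.zero_apply, Finset.sum_const_zero, b, CharTwo.add_self_eq_zero]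
  -- Each path changes sides, so two of them lead from gadget `0` to gadget `i` on the same side.
  obtain ⟨c, hc⟩ : ∃ c, TwistedAt b c true i := ⟨_, (hc.add_path 0 0).add_path i 0⟩
  have key := Formula.sat_iff_of_backAndForth (A := A) (B := B) (r := q + 2) (k := k) (by omega)
    (Γ := ThetaEdge q (k + 1) → ZMod 2) shift
    (fun α c => ∃ β i, TwistedAt b c β i ∧
      ∀ x, ¬ (show ThetaEdge q (k + 1) × ZMod 2 from α x).1.Touches β i)
    (by
      rintro α c ⟨β, i, hc, hα⟩ n R v
      exact relMap_thetaStructure_shift hc hα n R v)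
    (by
      rintro α c ⟨β, i, hc, hα⟩ α' T hT hαα
      obtain ⟨c', j, hc', hj, hcc⟩ := exists_twistedAt_of_card_le hc
        (p := fun x => (show ThetaEdge q (k + 1) × ZMod 2 from α x).1)
        (p' := fun x => (show ThetaEdge q (k + 1) × ZMod 2 from α' x).1) hα hT
        (fun x hx => congrArg Prod.fst (hαα x hx))
      exact ⟨c', ⟨_, j, hc', hj⟩, fun x => Prod.ext rfl (congrArg (_ + ·) (hcc x))⟩)
    φ ((shift c).symm ∘ γ) c ⟨true, i, hc, hi⟩
  have hγ : shift c ∘ (shift c).symm ∘ γ = γ := funext fun x => (shift c).apply_symm_apply (γ x)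
  have hA := (hφ A).1 thetaStructure_zero_mem_csp ((shift c).symm ∘ γ)
  rw [key] at hA
  exact hγ ▸ hA

end ParityStructures

end GenQuant

/-! ### The hierarchy theorem -/

theorem mainTheorem5 (r : ℕ) (hr : 3 ≤ r) :
    GenQuant.LogicLT (GenQuant.maltsevQuantifiers r) (GenQuant.maltsevQuantifiers (r + 1)) ∧
    GenQuant.HasMaltsevPolymorphism (GenQuant.parityTemplate (r + 1)) ∧
    GenQuant.cspQuantifier (GenQuant.parityTemplate (r + 1)) ∈
      GenQuant.maltsevQuantifiers (r + 1) ∧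
    GenQuant.Definable (GenQuant.maltsevQuantifiers (r + 1))
      (GenQuant.CSP (GenQuant.parityTemplate (r + 1))) ∧
    ¬ GenQuant.Definable (GenQuant.quantifiersOfArity r)
      (GenQuant.CSP (GenQuant.parityTemplate (r + 1))) := by
  have hmem := GenQuant.cspQuantifier_parityTemplate_mem (r + 1)
  have hdef := GenQuant.Quantifier.definable_cls _ hmem hmem.1
  have hnot : ¬ GenQuant.Definable (GenQuant.quantifiersOfArity r)
      (GenQuant.CSP (GenQuant.parityTemplate (r + 1))) := by
    obtain ⟨q, rfl⟩ := Nat.exists_eq_add_of_le' (show 2 ≤ r by omega)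
    exact GenQuant.not_definable_csp_parityTemplate q
  refine ⟨⟨fun σ _ C hC => hC.mono (GenQuant.maltsevQuantifiers_subset_succ r), fun hle => ?_⟩,
    GenQuant.hasMaltsevPolymorphism_parityTemplate (r + 1), hmem, hdef, hnot⟩
  -- A collapse would define the parity CSP by quantifiers of arity at most `r`, Maltsev-closed or
  -- not.
  exact hnot ((hle _ _ hdef).mono fun _ hq => hq.1)
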